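/- Let $q$ be a prime power, let $n,a,b,t$ be positive integers and let $V$ be an $n$-dimensional vector space over the field $\mathbb F_q$ with $q$ elements. Write $\binom{V}{k}_q$ for the set of all $k$-dimensional subspaces of $V$ and $$\binom{m}{k}_q=\prod_{i=0}^{k-1}\frac{q^{m-i}-1}{q^{k-i}-1}$$ for the Gaussian binomial coefficient, which is $0$ when $k>m$. Suppose that $n\ge 4$, $a,b\ge 2$, $t<\min\{a,b\}$, $a+b<n+t$ and $\binom{n}{a}_q\le\binom{n}{b}_q$. Let $\mathcal A\subseteq\binom{V}{a}_q$ and $\mathcal B\subseteq\binom{V}{b}_q$ be non-empty families that are cross-$t$-intersecting, i.e. $\dim(A\cap B)\ge t$ for all $A\in\mathcal A$ and $B\in\mathcal B$. Then $$|\mathcal A|+|\mathcal B|\le\binom{n}{b}_q-\sum_{i=0}^{t-1}q^{(a-i)(b-i)}\binom{a}{i}_q\binom{n-a}{b-i}_q+1 .$$ Moreover, equality holds if and only if one of the following is true: 1. there is $A\in\binom{V}{a}_q$ such that $\mathcal A=\{A\}$ and $\mathcal B=\{T\in\binom{V}{b}_q:\dim(A\cap T)\ge t\}$; 2. $\binom{n}{a}_q=\binom{n}{b}_q$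 and there is $B\in\binom{V}{b}_q$ such that $\mathcal B=\{B\}$ and $\mathcal A=\{S\in\binom{V}{a}_q:\dim(S\cap B)\ge t\}$. -/

import Mathlib

/-- The Gaussian binomial coefficient
`[n, k]_q = ∏_{i=0}^{k-1} (q^(n-i) - 1) / (q^(k-i) - 1)`, as a rational number.
For `k > n` the factor with index `i = n` makes the product vanish. -/
def gaussBinom (q n k : ℕ) : ℚ :=
  ∏ i ∈ Finset.range k, ((q : ℚ) ^ (n - i) - 1) / ((q : ℚ) ^ (k - i) - 1)

/-- The set `[V, k]` of all `k`-dimensional subspaces of `V`. -/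
def kSubspaces (K V : Type*) [Field K] [AddCommGroup V] [Module K V] (k : ℕ) :
    Set (Submodule K V) :=
  {W | Module.finrank K W = k}

/-- Two families of subspaces are cross-`t`-intersecting if every member of the first meets
every member of the second in a subspace of dimension at least `t`. -/
def CrossIntersecting {K V : Type*} [Field K] [AddCommGroup V] [Module K V] (t : ℕ)
    (𝒜 ℬ : Set (Submodule K V)) : Prop :=
  ∀ S ∈ 𝒜, ∀ T ∈ ℬ, t ≤ Module.finrank K (S ⊓ T : Submodule K V)

/-- The neighbourhood `N(S)` of a subspace `S` in `[V, k]`: the `k`-dimensional subspaces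
meeting `S` in dimension less than `t`. -/
def nbhd {K V : Type*} [Field K] [AddCommGroup V] [Module K V] (t k : ℕ)
    (S : Submodule K V) : Set (Submodule K V) :=
  {T ∈ kSubspaces K V k | Module.finrank K (S ⊓ T : Submodule K V) < t}

/-! Take a cross pair `(𝒜, ℬ)` of maximal total size with `|𝒜| ≤ |ℬ|`; the claim is `|𝒜| = 1`. For
`γ` in `GL(V)`, the pairs `(𝒜 ∩ γ𝒜, ℬ ∪ γℬ)` and `(𝒜 ∪ γ𝒜, ℬ ∩ γℬ)` have total sizes adding up to
twice the maximum, so if `𝒜` meets `γ𝒜` then both are again maximal (`IsMaxCrossPair.inter_union`).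

Induct on `|𝒜|`. If `𝒜 ∩ γ𝒜` is non-empty and smaller than `𝒜`, it is some `{C}`, and `ℬ ∪ γℬ`
consists of all `b`-spaces meeting `C` in dimension at least `t`. This contradicts
`Submodule.exists_finrank_inf_separating`, applied to `C` and further members of `𝒜` and `γ𝒜`.
Otherwise `𝒜` is a block of `GL(V)`; by primitivity (`Submodule.mem_of_isBlock`) `|𝒜| > 1` makes it
contain every `a`-space, which `a + b < n + t` forbids.

By symmetry one side of any maximal pair is a singleton. Double counting pairs meeting in dimension
less than `t` decides which side is better, and counting spaces by their intersection with a fixed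
`A` gives the formula. -/

/-! ### Subspaces meeting given subspaces in small dimension -/

section SubspaceAvoidance

variable {K V : Type*} [Field K] [AddCommGroup V] [Module K V]

/-- No vector space is a union of two proper subspaces, even over `𝔽₂`, where three can suffice.
Hence the argument never avoids more than two at once. -/
theorem Submodule.exists_notMem_and_notMem {P Q : Submodule K V} (hP : P ≠ ⊤) (hQ : Q ≠ ⊤) :
    ∃ v, v ∉ P ∧ v ∉ Q := by
  obtain ⟨x, -, hx⟩ := SetLike.exists_of_lt hP.lt_top
  obtain ⟨y, -, hy⟩ := SetLike.exists_of_lt hQ.lt_top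
  by_cases hxQ : x ∈ Q
  · by_cases hyP : y ∈ P
    · exact ⟨x + y, fun h => hx ((P.add_mem_iff_left hyP).1 h),
        fun h => hy ((Q.add_mem_iff_right hxQ).1 h)⟩
    · exact ⟨y, hyP, hy⟩
  · exact ⟨x, hx, hxQ⟩

theorem Submodule.exists_mem_notMem_and_notMem {S P Q : Submodule K V} (hP : ¬ S ≤ P)
    (hQ : ¬ S ≤ Q) : ∃ v ∈ S, v ∉ P ∧ v ∉ Q := by
  obtain ⟨v, h1, h2⟩ := Submodule.exists_notMem_and_notMem
    (P := P.comap S.subtype) (Q := Q.comap S.subtype)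
    (by rwa [ne_eq, Submodule.comap_subtype_eq_top])
    (by rwa [ne_eq, Submodule.comap_subtype_eq_top])
  exact ⟨v, v.2, h1, h2⟩

theorem Module.Dual.exists_vanishing_ne_zero {S : Submodule K V} {x y : V} (hx : x ∉ S)
    (hy : y ∉ S) : ∃ f : Module.Dual K V, (∀ s ∈ S, f s = 0) ∧ f x ≠ 0 ∧ f y ≠ 0 := by
  obtain ⟨f, hf, hfS⟩ := Submodule.exists_le_ker_of_notMem hx
  obtain ⟨g, hg, hgS⟩ := Submodule.exists_le_ker_of_notMem hy
  by_cases hfy : f y = 0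
  · by_cases hgx : g x = 0
    · exact ⟨f + g, fun s hs => by simp [show f s = 0 from hfS hs, show g s = 0 from hgS hs],
        by simpa [hgx], by simpa [hfy]⟩
    · exact ⟨g, fun s hs => hgS hs, hgx, hg⟩
  · exact ⟨f, fun s hs => hfS hs, hf, hfy⟩

variable [FiniteDimensional K V]

theorem Submodule.finrank_sup_span_singleton_le (W : Submodule K V) (v : V) :
    Module.finrank K (W ⊔ K ∙ v : Submodule K V) ≤ Module.finrank K W + 1 := by
  have h1 := Submodule.finrank_add_le_finrank_add_finrank W (K ∙ v)
  have h2 : Module.finrank K (K ∙ v) ≤ 1 := by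
    simpa using finrank_span_le_card (R := K) ({v} : Set V)
  omega

theorem Submodule.finrank_sup_span_singleton_of_notMem {W : Submodule K V} {v : V} (hv : v ∉ W) :
    Module.finrank K (W ⊔ K ∙ v : Submodule K V) = Module.finrank K W + 1 := by
  have h1 := W.finrank_sup_span_singleton_le v
  have h2 : W < W ⊔ K ∙ v := by
    refine lt_of_le_of_ne le_sup_left fun h => hv ?_
    rw [h]
    exact Submodule.mem_sup_right (Submodule.mem_span_singleton_self v)
  have h3 := Submodule.finrank_lt_finrank_of_lt h2
  omega

theorem Submodule.exists_le_le_finrank_eq {W S : Submodule K V} (hWS : W ≤ S) {k : ℕ}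
    (hW : Module.finrank K W ≤ k) (hS : k ≤ Module.finrank K S) :
    ∃ E, W ≤ E ∧ E ≤ S ∧ Module.finrank K E = k := by
  induction k, hW using Nat.le_induction with
  | base => exact ⟨W, le_rfl, hWS, rfl⟩
  | succ k _ ih =>
    obtain ⟨E, hWE, hES, hE⟩ := ih (by omega)
    obtain ⟨v, hvS, hv⟩ := SetLike.exists_of_lt (lt_of_le_of_ne hES (by rintro rfl; omega))
    exact ⟨E ⊔ K ∙ v, hWE.trans le_sup_left,
      sup_le hES ((Submodule.span_singleton_le_iff_mem _ _).2 hvS),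
      by rw [Submodule.finrank_sup_span_singleton_of_notMem hv, hE]⟩

/-- Enlarging `B` by any vector outside a suitable proper subspace keeps its intersection with `T`
small. -/
theorem Submodule.exists_ne_top_forall_finrank_inf_lt {B T : Submodule K V} {a b t : ℕ}
    (hta : t ≤ a) (hab : a + b < Module.finrank K V + t) (hT : Module.finrank K T = a)
    (hB : Module.finrank K B < b) (hBT : Module.finrank K (T ⊓ B : Submodule K V) < t) :
    ∃ P : Submodule K V, P ≠ ⊤ ∧ B ≤ P ∧
      ∀ v ∉ P, Module.finrank K (T ⊓ (B ⊔ K ∙ v) : Submodule K V) < t := by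
  have e0 := Submodule.finrank_sup_add_finrank_inf_eq T B
  -- If `T + B = V`, the dimension formula bounds the new intersection by `a + b - n < t` for every
  -- `v ∉ B`. Otherwise `v ∉ T + B` leaves its dimension unchanged.
  by_cases h : T ⊔ B = ⊤
  · rw [h, finrank_top] at e0
    refine ⟨B, ?_, le_rfl, fun v hv => ?_⟩
    · rintro rfl
      rw [finrank_top] at hB
      omega
    · have e1 := Submodule.finrank_sup_add_finrank_inf_eq T (B ⊔ K ∙ v)
      rw [Submodule.finrank_sup_span_singleton_of_notMem hv, ← sup_assoc, h, top_sup_eq,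
        finrank_top] at e1
      omega
  · refine ⟨T ⊔ B, h, le_sup_right, fun v hv => ?_⟩
    have e1 := Submodule.finrank_sup_add_finrank_inf_eq T (B ⊔ K ∙ v)
    rw [Submodule.finrank_sup_span_singleton_of_notMem fun hvB => hv (Submodule.mem_sup_right hvB),
      ← sup_assoc, Submodule.finrank_sup_span_singleton_of_notMem hv] at e1
    omega

theorem Submodule.exists_ge_finrank_inf_lt {E T T' : Submodule K V} {a b t : ℕ}
    (hta : t ≤ a) (hab : a + b < Module.finrank K V + t) (hT : Module.finrank K T = a)
    (hT' : Module.finrank K T' = a) (hE : Module.finrank K E ≤ b)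
    (hET : Module.finrank K (T ⊓ E : Submodule K V) < t)
    (hET' : Module.finrank K (T' ⊓ E : Submodule K V) < t) :
    ∃ B, E ≤ B ∧ Module.finrank K B = b ∧ Module.finrank K (T ⊓ B : Submodule K V) < t ∧
      Module.finrank K (T' ⊓ B : Submodule K V) < t := by
  suffices H : ∀ m, Module.finrank K E ≤ m → m ≤ b → ∃ B, E ≤ B ∧ Module.finrank K B = m ∧
      Module.finrank K (T ⊓ B : Submodule K V) < t ∧
      Module.finrank K (T' ⊓ B : Submodule K V) < t from H b hE le_rfl
  intro m hm
  induction m, hm using Nat.le_induction with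
  | base => exact fun _ => ⟨E, le_rfl, rfl, hET, hET'⟩
  | succ m _ ih =>
    intro hmb
    obtain ⟨B, hEB, hB, hBT, hBT'⟩ := ih (by omega)
    obtain ⟨P, hP, hBP, H⟩ :=
      Submodule.exists_ne_top_forall_finrank_inf_lt hta hab hT (by omega) hBT
    obtain ⟨P', hP', hBP', H'⟩ :=
      Submodule.exists_ne_top_forall_finrank_inf_lt hta hab hT' (by omega) hBT'
    obtain ⟨v, hv, hv'⟩ := Submodule.exists_notMem_and_notMem hP hP'
    exact ⟨B ⊔ K ∙ v, hEB.trans le_sup_left,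
      by rw [Submodule.finrank_sup_span_singleton_of_notMem fun h => hv (hBP h), hB],
      H v hv, H' v hv'⟩

/-- A `b`-dimensional subspace meeting `S` in dimension at least `t`, but neither `T` nor `T'`. -/
theorem Submodule.exists_finrank_inf_separating {S T T' : Submodule K V} {a b t : ℕ} (ht : 1 ≤ t)
    (hta : t ≤ a) (htb : t ≤ b) (hab : a + b < Module.finrank K V + t)
    (hS : Module.finrank K S = a) (hT : Module.finrank K T = a) (hT' : Module.finrank K T' = a)
    (hST : S ≠ T) (hST' : S ≠ T') :
    ∃ B : Submodule K V, Module.finrank K B = b ∧ t ≤ Module.finrank K (S ⊓ B : Submodule K V) ∧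
      Module.finrank K (T ⊓ B : Submodule K V) < t ∧
      Module.finrank K (T' ⊓ B : Submodule K V) < t := by
  -- A `t`-dimensional subspace of `S` through such a `v` lies in neither `T` nor `T'`, so it can be
  -- enlarged to dimension `b` while keeping both intersections small.
  obtain ⟨v, hvS, hvT, hvT'⟩ := Submodule.exists_mem_notMem_and_notMem
    (fun h => hST (Submodule.eq_of_le_of_finrank_eq h (hS.trans hT.symm)))
    (fun h => hST' (Submodule.eq_of_le_of_finrank_eq h (hS.trans hT'.symm)))
  obtain ⟨E, hvE, hES, hE⟩ := Submodule.exists_le_le_finrank_eq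
    ((Submodule.span_singleton_le_iff_mem v S).2 hvS)
    ((by simpa using finrank_span_le_card (R := K) ({v} : Set V) :
      Module.finrank K (K ∙ v) ≤ 1).trans ht) (hta.trans hS.ge)
  rw [Submodule.span_singleton_le_iff_mem] at hvE
  have key : ∀ U : Submodule K V, v ∉ U → Module.finrank K (U ⊓ E : Submodule K V) < t := by
    intro U hU
    rw [← hE]
    exact Submodule.finrank_lt_finrank_of_lt
      (lt_of_le_of_ne inf_le_right fun h => hU (inf_eq_right.1 h hvE))
  obtain ⟨B, hEB, hB, h1, h2⟩ := Submodule.exists_ge_finrank_inf_lt hta hab hT hT'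
    (hE.trans_le htb) (key T hvT) (key T' hvT')
  exact ⟨B, hB, hE.ge.trans (Submodule.finrank_mono (le_inf hES hEB)), h1, h2⟩

end SubspaceAvoidance

/-! ### Primitivity of `GL(V)` on `k`-dimensional subspaces -/

section Primitivity

variable {K V : Type*} [Field K] [AddCommGroup V] [Module K V]

/-- Scale a functional vanishing on `S` so that `f x = 1`; then `z ↦ z + f z • (y - x)` sends `x` to
`y`. It is invertible because `1 + f (y - x) = f y ≠ 0`. -/
theorem LinearEquiv.exists_fixing_apply_eq {S : Submodule K V} {x y : V} (hx : x ∉ S)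
    (hy : y ∉ S) : ∃ (f : Module.Dual K V) (h : IsUnit (1 + f (y - x))),
      (∀ s ∈ S, f s = 0) ∧ LinearEquiv.dilatransvection h x = y := by
  obtain ⟨f, hS, hfx, hfy⟩ := Module.Dual.exists_vanishing_ne_zero hx hy
  refine ⟨(f x)⁻¹ • f, ?_, fun s hs => by simp [hS s hs], ?_⟩
  · rw [isUnit_iff_ne_zero]
    simp [mul_sub, hfx, hfy]
  · rw [LinearEquiv.dilatransvection.apply]
    simp [hfx]

theorem LinearEquiv.dilatransvection_apply_mem_iff {f : Module.Dual K V} {v : V}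
    (h : IsUnit (1 + f v)) {S : Submodule K V} (hv : v ∈ S) (x : V) :
    LinearEquiv.dilatransvection h x ∈ S ↔ x ∈ S := by
  rw [LinearEquiv.dilatransvection.apply]
  exact S.add_mem_iff_left (S.smul_mem _ hv)

theorem Submodule.map_dilatransvection_eq {f : Module.Dual K V} {v : V}
    (h : IsUnit (1 + f v)) {S : Submodule K V} (hv : v ∈ S) :
    S.map (LinearEquiv.dilatransvection h).toLinearMap = S := by
  ext x
  rw [Submodule.mem_map_equiv, ← LinearEquiv.dilatransvection_apply_mem_iff h hv,
    LinearEquiv.apply_symm_apply]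

theorem Submodule.map_dilatransvection_eq_of_vanishing {f : Module.Dual K V} {v : V}
    (h : IsUnit (1 + f v)) {S : Submodule K V} (hf : ∀ s ∈ S, f s = 0) :
    S.map (LinearEquiv.dilatransvection h).toLinearMap = S := by
  have key : ∀ s ∈ S, LinearEquiv.dilatransvection h s = s := fun s hs => by
    rw [LinearEquiv.dilatransvection.apply, hf s hs, zero_smul, add_zero]
  ext x
  rw [Submodule.mem_map]
  refine ⟨?_, fun hx => ⟨x, hx, key x hx⟩⟩
  rintro ⟨s, hs, rfl⟩
  rwa [LinearEquiv.coe_coe, key s hs]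

/-- The general linear group acts primitively on the subspaces of a given dimension. -/
theorem Submodule.mem_of_isBlock [FiniteDimensional K V] {k : ℕ} {𝒜 : Set (Submodule K V)}
    (hblock : ∀ γ : V ≃ₗ[K] V, ∀ S ∈ 𝒜, S.map γ.toLinearMap ∈ 𝒜 →
      ∀ U ∈ 𝒜, U.map γ.toLinearMap ∈ 𝒜)
    (hk : ∀ S ∈ 𝒜, Module.finrank K S = k) {S T : Submodule K V} (hS : S ∈ 𝒜) (hT : T ∈ 𝒜)
    (hST : S ≠ T) {U : Submodule K V} (hU : Module.finrank K U = k) : U ∈ 𝒜 := by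
  obtain ⟨x, hxT, hxS⟩ := SetLike.not_le_iff_exists.1 fun h : T ≤ S =>
    hST (Submodule.eq_of_le_of_finrank_eq h ((hk T hT).trans (hk S hS).symm)).symm
  -- A dilatransvection in direction `v` fixes any subspace containing `v`, so it suffices to find a
  -- member of `𝒜` through `v`. If `v ∉ S`, move `x ∈ T` to `v` by a map fixing `S`: the image of
  -- `T` is such a member.
  have hdil : ∀ (f : Module.Dual K V) (v : V) (h : IsUnit (1 + f v)), ∀ R ∈ 𝒜,
      R.map (LinearEquiv.dilatransvection h).toLinearMap ∈ 𝒜 := by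
    intro f v h
    by_cases hv : v ∈ S
    · exact hblock _ S hS (by rwa [Submodule.map_dilatransvection_eq h hv])
    obtain ⟨g, hg, hgS, hgx⟩ := LinearEquiv.exists_fixing_apply_eq hxS hv
    set γ := LinearEquiv.dilatransvection hg with hγ
    have hγ𝒜 : ∀ R ∈ 𝒜, R.map γ.toLinearMap ∈ 𝒜 := hblock γ S hS
      (by rwa [hγ, Submodule.map_dilatransvection_eq_of_vanishing hg hgS])
    have hconj : (T.map γ.toLinearMap).map (LinearEquiv.dilatransvection h).toLinearMap
        = T.map γ.toLinearMap := by
      refine Submodule.map_dilatransvection_eq h ?_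
      rw [← hgx]
      exact Submodule.mem_map_of_mem hxT
    exact hblock _ _ (hγ𝒜 T hT) (by rw [hconj]; exact hγ𝒜 T hT)
  -- Walk from `S` to `U` inside `𝒜`: each dilatransvection fixes `R ⊓ U` and exchanges a vector of
  -- `R` for one of `U`; `m` bounds the remaining steps.
  suffices H : ∀ m, ∀ R ∈ 𝒜, k ≤ Module.finrank K (R ⊓ U : Submodule K V) + m → U ∈ 𝒜 from
    H k S hS (by omega)
  intro m
  induction m with
  | zero =>
    intro R hR h
    have h1 : R ⊓ U = R := Submodule.eq_of_le_of_finrank_le inf_le_left (by rw [hk R hR]; omega)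
    rwa [← Submodule.eq_of_le_of_finrank_eq (inf_eq_left.1 h1) ((hk R hR).trans hU.symm)]
  | succ m ih =>
    intro R hR h
    by_cases hRU : R = U
    · rwa [← hRU]
    obtain ⟨x, hxR, hxU⟩ := SetLike.not_le_iff_exists.1 fun h : R ≤ U =>
      hRU (Submodule.eq_of_le_of_finrank_eq h ((hk R hR).trans hU.symm))
    obtain ⟨y, hyU, hyR⟩ := SetLike.not_le_iff_exists.1 fun h : U ≤ R =>
      hRU (Submodule.eq_of_le_of_finrank_eq h (hU.trans (hk R hR).symm)).symm
    obtain ⟨f, hf, hfS, hfx⟩ := LinearEquiv.exists_fixing_apply_eq (S := R ⊓ U)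
      (fun h => hxU h.2) (fun h => hyR h.1)
    refine ih _ (hdil f _ hf R hR) ?_
    have hle : (R ⊓ U) ⊔ K ∙ y ≤ R.map (LinearEquiv.dilatransvection hf).toLinearMap ⊓ U := by
      refine sup_le (le_inf ?_ inf_le_right)
        ((Submodule.span_singleton_le_iff_mem _ _).2 ⟨⟨x, hxR, hfx⟩, hyU⟩)
      conv_lhs => rw [← Submodule.map_dilatransvection_eq_of_vanishing hf hfS]
      exact Submodule.map_mono inf_le_left
    have h1 := Submodule.finrank_mono hle
    rw [Submodule.finrank_sup_span_singleton_of_notMem fun h : y ∈ R ⊓ U => hyR h.1] at h1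
    omega

end Primitivity

/-! ### Cross pairs of maximal total size -/

section MaximalPairs

variable {K V : Type*} [Field K] [AddCommGroup V] [Module K V]

/-- Non-empty cross-`t`-intersecting families of `a`- and of `b`-dimensional subspaces. -/
structure IsCrossPair (t a b : ℕ) (𝒜 ℬ : Set (Submodule K V)) : Prop where
  left_subset : 𝒜 ⊆ kSubspaces K V a
  right_subset : ℬ ⊆ kSubspaces K V b
  left_nonempty : 𝒜.Nonempty
  right_nonempty : ℬ.Nonempty
  cross : CrossIntersecting t 𝒜 ℬ

/-- Cross pairs of the largest possible total size. -/
structure IsMaxCrossPair (t a b : ℕ) (𝒜 ℬ : Set (Submodule K V)) : Prop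
    extends IsCrossPair t a b 𝒜 ℬ where
  ncard_add_le : ∀ 𝒜' ℬ' : Set (Submodule K V), IsCrossPair t a b 𝒜' ℬ' →
    𝒜'.ncard + ℬ'.ncard ≤ 𝒜.ncard + ℬ.ncard

theorem CrossIntersecting.symm {t : ℕ} {𝒜 ℬ : Set (Submodule K V)}
    (h : CrossIntersecting t 𝒜 ℬ) : CrossIntersecting t ℬ 𝒜 := fun T hT S hS => by
  rw [inf_comm]
  exact h S hS T hT

theorem IsCrossPair.symm {t a b : ℕ} {𝒜 ℬ : Set (Submodule K V)} (h : IsCrossPair t a b 𝒜 ℬ) :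
    IsCrossPair t b a ℬ 𝒜 :=
  ⟨h.2, h.1, h.4, h.3, h.5.symm⟩

theorem IsMaxCrossPair.symm {t a b : ℕ} {𝒜 ℬ : Set (Submodule K V)}
    (h : IsMaxCrossPair t a b 𝒜 ℬ) : IsMaxCrossPair t b a ℬ 𝒜 :=
  ⟨h.1.symm, fun ℬ' 𝒜' h' => by
    rw [add_comm, add_comm ℬ.ncard]
    exact h.2 𝒜' ℬ' h'.symm⟩

theorem IsCrossPair.map {t a b : ℕ} {𝒜 ℬ : Set (Submodule K V)} (h : IsCrossPair t a b 𝒜 ℬ)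
    (γ : V ≃ₗ[K] V) :
    IsCrossPair t a b (Submodule.map γ.toLinearMap '' 𝒜) (Submodule.map γ.toLinearMap '' ℬ) where
  left_subset := by
    rintro _ ⟨S, hS, rfl⟩
    exact (LinearEquiv.finrank_map_eq γ S).trans (h.1 hS)
  right_subset := by
    rintro _ ⟨S, hS, rfl⟩
    exact (LinearEquiv.finrank_map_eq γ S).trans (h.2 hS)
  left_nonempty := h.3.image _
  right_nonempty := h.4.image _
  cross := by
    rintro _ ⟨S, hS, rfl⟩ _ ⟨T, hT, rfl⟩
    rw [← Submodule.map_inf _ γ.injective]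
    exact (h.5 S hS T hT).trans (LinearEquiv.finrank_map_eq γ (S ⊓ T)).ge

theorem ncard_image_map (γ : V ≃ₗ[K] V) (𝒜 : Set (Submodule K V)) :
    (Submodule.map γ.toLinearMap '' 𝒜).ncard = 𝒜.ncard :=
  Set.ncard_image_of_injective _ (Submodule.map_injective_of_injective γ.injective)

theorem IsCrossPair.inter_union {t a b : ℕ} {𝒜 ℬ 𝒜' ℬ' : Set (Submodule K V)}
    (h : IsCrossPair t a b 𝒜 ℬ) (h' : IsCrossPair t a b 𝒜' ℬ') (hne : (𝒜 ∩ 𝒜').Nonempty) :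
    IsCrossPair t a b (𝒜 ∩ 𝒜') (ℬ ∪ ℬ') where
  left_subset := Set.inter_subset_left.trans h.1
  right_subset := Set.union_subset h.2 h'.2
  left_nonempty := hne
  right_nonempty := h.4.mono Set.subset_union_left
  cross := fun S hS T hT => hT.elim (h.5 S hS.1 T) (h'.5 S hS.2 T)

variable [Finite V]

theorem IsMaxCrossPair.inter_union {t a b : ℕ} {𝒜 ℬ 𝒜' ℬ' : Set (Submodule K V)}
    (h : IsMaxCrossPair t a b 𝒜 ℬ) (h' : IsCrossPair t a b 𝒜' ℬ')
    (hc : 𝒜'.ncard = 𝒜.ncard) (hc' : ℬ'.ncard = ℬ.ncard) (hle : 𝒜.ncard ≤ ℬ.ncard)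
    (hne : (𝒜 ∩ 𝒜').Nonempty) : IsMaxCrossPair t a b (𝒜 ∩ 𝒜') (ℬ ∪ ℬ') := by
  have e1 := Set.ncard_union_add_ncard_inter 𝒜 𝒜'
  have e2 := Set.ncard_union_add_ncard_inter ℬ ℬ'
  have h1 := h.toIsCrossPair.inter_union h' hne
  have hpos := (Set.ncard_pos (Set.toFinite _)).2 hne
  have hBB : (ℬ' ∩ ℬ).Nonempty := by
    rw [Set.inter_comm, Set.nonempty_iff_ne_empty]
    intro hemp
    have := h.2 _ _ h1
    rw [hemp, Set.ncard_empty] at e2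
    omega
  have h2 := h.2 _ _ (h'.symm.inter_union h.toIsCrossPair.symm hBB).symm
  rw [Set.union_comm 𝒜' 𝒜, Set.inter_comm ℬ' ℬ] at h2
  exact ⟨h1, fun 𝒞 𝒟 hCD => (h.2 𝒞 𝒟 hCD).trans (by omega)⟩

theorem IsMaxCrossPair.eq_of_left_singleton {t a b : ℕ} {S : Submodule K V}
    {ℬ : Set (Submodule K V)} (h : IsMaxCrossPair t a b {S} ℬ) :
    ℬ = kSubspaces K V b \ nbhd t b S := by
  have hsub : ℬ ⊆ kSubspaces K V b \ nbhd t b S := fun T hT =>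
    ⟨h.right_subset hT, fun hT' => (h.cross S rfl T hT).not_gt hT'.2⟩
  have := h.2 {S} (kSubspaces K V b \ nbhd t b S) ⟨h.left_subset, Set.sdiff_subset,
    h.left_nonempty, h.right_nonempty.mono hsub, by
      rintro _ rfl T ⟨hT, hT'⟩
      exact not_lt.1 fun hlt => hT' ⟨hT, hlt⟩⟩
  exact Set.eq_of_subset_of_ncard_le hsub (by omega)

/-- Strong induction on `|𝒜|`: a larger `𝒜` either has a smaller non-empty intersection with a
translate or is a block. -/
theorem IsMaxCrossPair.ncard_left_eq_one {t a b : ℕ} (ht : 1 ≤ t) (hta : t ≤ a) (htb : t ≤ b)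
    (hab : a + b < Module.finrank K V + t) {𝒜 ℬ : Set (Submodule K V)}
    (h : IsMaxCrossPair t a b 𝒜 ℬ) (hle : 𝒜.ncard ≤ ℬ.ncard) : 𝒜.ncard = 1 := by
  have : FiniteDimensional K V := Module.Finite.of_finite
  induction hm : 𝒜.ncard using Nat.strong_induction_on generalizing 𝒜 ℬ with
  | _ m ih =>
  subst hm
  by_contra hne
  have hpos := (Set.ncard_pos (Set.toFinite _)).2 h.left_nonempty
  obtain ⟨S, hS, T, hT, hST⟩ := (Set.one_lt_ncard (Set.toFinite 𝒜)).1 (by omega)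
  have hblock : ∀ γ : V ≃ₗ[K] V, ∀ S ∈ 𝒜, S.map γ.toLinearMap ∈ 𝒜 →
      ∀ U ∈ 𝒜, U.map γ.toLinearMap ∈ 𝒜 := by
    intro γ R hR hRγ U hU
    set 𝒜' := Submodule.map γ.toLinearMap '' 𝒜 with h𝒜'
    have hc : 𝒜'.ncard = 𝒜.ncard := ncard_image_map γ 𝒜
    have hi := h.inter_union (h.toIsCrossPair.map γ) hc (ncard_image_map γ ℬ) hle
      ⟨_, hRγ, R, hR, rfl⟩
    by_cases hlt : (𝒜 ∩ 𝒜').ncard < 𝒜.ncard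
    · exfalso
      have hl : (𝒜 ∩ 𝒜').ncard ≤ (ℬ ∪ Submodule.map γ.toLinearMap '' ℬ).ncard :=
        (hlt.le.trans hle).trans (Set.ncard_le_ncard Set.subset_union_left)
      obtain ⟨C, hC⟩ := Set.ncard_eq_one.1 (ih _ hlt hi hl rfl)
      rw [hC] at hi
      have hC𝒜 : C ∈ 𝒜 ∩ 𝒜' := hC ▸ rfl
      obtain ⟨D, hD, hDC⟩ := Set.exists_ne_of_one_lt_ncard (by omega : 1 < 𝒜.ncard) C
      obtain ⟨D', hD', hDC'⟩ := Set.exists_ne_of_one_lt_ncard (by omega : 1 < 𝒜'.ncard) C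
      -- This `B` belongs to `ℬ ∪ γℬ` because of `C`, yet `D` keeps it out of `ℬ` and `D'` out of
      -- `γℬ`.
      obtain ⟨B, hB, hCB, hDB, hDB'⟩ := Submodule.exists_finrank_inf_separating ht hta htb hab
        (h.left_subset hC𝒜.1) (h.left_subset hD) ((h.toIsCrossPair.map γ).left_subset hD')
        hDC.symm hDC'.symm
      have hBmem : B ∈ kSubspaces K V b \ nbhd t b C := ⟨hB, fun hB' => hCB.not_gt hB'.2⟩
      rw [← hi.eq_of_left_singleton] at hBmem
      rcases hBmem with hB' | hB'
      · exact (h.cross D hD B hB').not_gt hDB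
      · exact ((h.toIsCrossPair.map γ).cross D' hD' B hB').not_gt hDB'
    · have heq : 𝒜 ∩ 𝒜' = 𝒜' :=
        Set.eq_of_subset_of_ncard_le Set.inter_subset_right (by omega)
      exact Set.inter_eq_right.1 heq ⟨U, hU, rfl⟩
  obtain ⟨B, hB⟩ := h.right_nonempty
  have hBb : Module.finrank K B = b := h.right_subset hB
  -- Starting from `⊥`, grow an `a`-space meeting `B` in dimension less than `t`; only one space is
  -- avoided, so it is passed twice.
  obtain ⟨U, -, hU, hUB, -⟩ := Submodule.exists_ge_finrank_inf_lt (E := ⊥) (T := B) (T' := B)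
    htb (by omega) hBb hBb (by simp : _ ≤ a)
    (by rwa [inf_bot_eq, finrank_bot]) (by rwa [inf_bot_eq, finrank_bot])
  have hU𝒜 := Submodule.mem_of_isBlock hblock (fun S hS => h.left_subset hS) hS hT hST hU
  have := h.cross U hU𝒜 B hB
  rw [inf_comm] at this
  omega

theorem IsMaxCrossPair.singleton_or_singleton {t a b : ℕ} (ht : 1 ≤ t) (hta : t ≤ a)
    (htb : t ≤ b) (hab : a + b < Module.finrank K V + t) {𝒜 ℬ : Set (Submodule K V)}
    (h : IsMaxCrossPair t a b 𝒜 ℬ) :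
    (∃ A ∈ kSubspaces K V a, 𝒜 = {A} ∧ ℬ = kSubspaces K V b \ nbhd t b A) ∨
      ∃ B ∈ kSubspaces K V b, ℬ = {B} ∧ 𝒜 = kSubspaces K V a \ nbhd t a B := by
  rcases le_total 𝒜.ncard ℬ.ncard with hle | hle
  · obtain ⟨A, rfl⟩ := Set.ncard_eq_one.1 (h.ncard_left_eq_one ht hta htb hab hle)
    exact Or.inl ⟨A, h.left_subset rfl, rfl, h.eq_of_left_singleton⟩
  · obtain ⟨B, rfl⟩ := Set.ncard_eq_one.1
      (h.symm.ncard_left_eq_one ht htb hta (by omega) hle)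
    exact Or.inr ⟨B, h.right_subset rfl, rfl, h.symm.eq_of_left_singleton⟩

theorem IsCrossPair.exists_isMaxCrossPair {t a b : ℕ} {𝒜 ℬ : Set (Submodule K V)}
    (h : IsCrossPair t a b 𝒜 ℬ) : ∃ 𝒜' ℬ' : Set (Submodule K V), IsMaxCrossPair t a b 𝒜' ℬ' := by
  obtain ⟨⟨𝒜', ℬ'⟩, h', hmax⟩ := Set.exists_max_image
    {p : Set (Submodule K V) × Set (Submodule K V) | IsCrossPair t a b p.1 p.2}
    (fun p => p.1.ncard + p.2.ncard) (Set.toFinite _) ⟨(𝒜, ℬ), h⟩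
  exact ⟨𝒜', ℬ', h', fun 𝒞 𝒟 hCD => hmax (𝒞, 𝒟) hCD⟩

end MaximalPairs

/-! ### Counting subspaces through linearly independent tuples -/

section Counting

section

variable {K V : Type*} [Field K] [AddCommGroup V] [Module K V]

theorem LinearIndependent.inf_sup_span_eq {A W : Submodule K V} (hWA : W ≤ A) {m : ℕ}
    {f : Fin m → V} (hf : LinearIndependent K (A.mkQ ∘ f)) :
    A ⊓ (W ⊔ Submodule.span K (Set.range f)) = W := by
  have hd : Submodule.span K (Set.range f) ⊓ A = ⊥ := by
    simpa using (Submodule.range_ker_disjoint hf).eq_bot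
  rw [inf_comm, sup_inf_assoc_of_le _ hWA, hd, sup_bot_eq]

/-- Since `A ⊓ T = W`, the map `T / W → V / A` is injective. -/
theorem linearIndependent_mkQ_comap_iff {A W T : Submodule K V} (hT : A ⊓ T = W) {m : ℕ}
    (g : Fin m → T) : LinearIndependent K ((W.comap T.subtype).mkQ ∘ g) ↔
      LinearIndependent K (A.mkQ ∘ fun i => (g i : V)) := by
  have hle : W.comap T.subtype ≤ A.comap T.subtype :=
    Submodule.comap_mono (hT ▸ inf_le_left)
  rw [← LinearMap.linearIndependent_iff ((W.comap T.subtype).mapQ A T.subtype hle)]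
  · rfl
  · rw [Submodule.mapQ, Submodule.ker_liftQ, ← le_bot_iff, Submodule.map_le_iff_le_comap,
      Submodule.comap_bot, Submodule.ker_mkQ]
    intro x hx
    rw [LinearMap.mem_ker, LinearMap.comp_apply, ← LinearMap.mem_ker, A.ker_mkQ] at hx
    exact hT ▸ ⟨hx, x.2⟩

end

variable {K V : Type*} [Field K] [Fintype K] [AddCommGroup V] [Module K V] [Finite V]

/-- When `m` exceeds the dimension, the factor with `j = dim V` is zero, so no bound on `m` is
needed. -/
theorem Nat.card_linearIndependent (m : ℕ) :
    Nat.card {f : Fin m → V // LinearIndependent K f} =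
      ∏ j : Fin m, (Fintype.card K ^ Module.finrank K V - Fintype.card K ^ (j : ℕ)) := by
  have : FiniteDimensional K V := Module.Finite.of_finite
  by_cases hm : m ≤ Module.finrank K V
  · exact _root_.card_linearIndependent hm
  · rw [Finset.prod_eq_zero (Finset.mem_univ ⟨Module.finrank K V, not_le.1 hm⟩) (by simp)]
    have : IsEmpty {f : Fin m → V // LinearIndependent K f} :=
      ⟨fun f => hm (by simpa using f.2.fintype_card_le_finrank)⟩
    exact Nat.card_of_isEmpty

/-- A linear section of `V → V / A` splits each tuple into an independent tuple of the quotient and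
an arbitrary tuple of `A`. -/
theorem Nat.card_linearIndependent_mkQ (A : Submodule K V) (m : ℕ) :
    Nat.card {f : Fin m → V // LinearIndependent K (A.mkQ ∘ f)} =
      (Fintype.card K ^ Module.finrank K A) ^ m *
        ∏ j : Fin m, (Fintype.card K ^ Module.finrank K (V ⧸ A) - Fintype.card K ^ (j : ℕ)) := by
  have : Finite (V ⧸ A) := Finite.of_surjective _ A.mkQ_surjective
  obtain ⟨g, hg⟩ := A.mkQ.exists_rightInverse_of_surjective A.range_mkQ
  have hg' : ∀ x, A.mkQ (g x) = x := LinearMap.congr_fun hg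
  let e : {f : Fin m → V // LinearIndependent K (A.mkQ ∘ f)} ≃
      (Fin m → A) × {h : Fin m → V ⧸ A // LinearIndependent K h} :=
    { toFun := fun f => (fun i => ⟨f.1 i - g (A.mkQ (f.1 i)), 
        A.ker_mkQ.le (LinearMap.mem_ker.2 (by rw [map_sub, hg', sub_self]))⟩, ⟨_, f.2⟩)
      invFun := fun p => ⟨fun i => p.1 i + g (p.2.1 i), by
        convert p.2.2
        ext i
        rw [Function.comp_apply, map_add, hg', (LinearMap.mem_ker.1 (A.ker_mkQ.ge (p.1 i).2)),
          zero_add]⟩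
      left_inv := fun f => by
        ext i
        simp
      right_inv := fun p => by
        have h0 : ∀ i, A.mkQ (p.1 i : V) = 0 := fun i =>
          LinearMap.mem_ker.1 (A.ker_mkQ.ge (p.1 i).2)
        ext i
        · simp only [map_add, hg', h0, zero_add, add_sub_cancel_right]
        · simp only [Function.comp_apply, map_add, hg', h0, zero_add] }
  rw [Nat.card_congr e, Nat.card_prod, Nat.card_linearIndependent, Nat.card_fun,
    Nat.card_fin, Module.natCard_eq_pow_finrank (K := K), Nat.card_eq_fintype_card]

theorem LinearIndependent.finrank_sup_span {A W : Submodule K V} (hWA : W ≤ A) {m : ℕ}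
    {f : Fin m → V} (hf : LinearIndependent K (A.mkQ ∘ f)) :
    Module.finrank K (W ⊔ Submodule.span K (Set.range f) : Submodule K V) =
      Module.finrank K W + m := by
  have : FiniteDimensional K V := Module.Finite.of_finite
  have h1 := Submodule.finrank_sup_add_finrank_inf_eq W (Submodule.span K (Set.range f))
  have h2 : W ⊓ Submodule.span K (Set.range f) = ⊥ := by
    have := hf.inf_sup_span_eq (bot_le : ⊥ ≤ A)
    rw [bot_sup_eq] at this
    exact le_bot_iff.1 ((inf_le_inf_right _ hWA).trans this.le)
  rw [h2, finrank_bot, finrank_span_eq_card hf.of_comp, Fintype.card_fin] at h1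
  exact h1

/-- Double counting: an `m`-tuple `f` independent modulo `A` lies in exactly one admissible `T`,
namely `W + span f`, and each `T` contains as many such tuples as are independent modulo `W`. -/
theorem ncard_inf_eq_mul (A W : Submodule K V) (hWA : W ≤ A) (m : ℕ) :
    {T : Submodule K V | Module.finrank K T = Module.finrank K W + m ∧ A ⊓ T = W}.ncard *
      ((Fintype.card K ^ Module.finrank K W) ^ m *
        ∏ j : Fin m, (Fintype.card K ^ m - Fintype.card K ^ (j : ℕ))) =
      (Fintype.card K ^ Module.finrank K A) ^ m *
        ∏ j : Fin m, (Fintype.card K ^ (Module.finrank K V - Module.finrank K A) -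
          Fintype.card K ^ (j : ℕ)) := by
  have : FiniteDimensional K V := Module.Finite.of_finite
  set 𝒯 := {T : Submodule K V | Module.finrank K T = Module.finrank K W + m ∧ A ⊓ T = W}
  let F : (Σ T : 𝒯, {g : Fin m → T.1 // LinearIndependent K ((W.comap T.1.subtype).mkQ ∘ g)}) →
      {f : Fin m → V // LinearIndependent K (A.mkQ ∘ f)} := fun p =>
    ⟨fun i => p.2.1 i, (linearIndependent_mkQ_comap_iff p.1.2.2 p.2.1).1 p.2.2⟩
  have hspan : ∀ p, W ⊔ Submodule.span K (Set.range (F p).1) = p.1.1 := fun p => by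
    refine Submodule.eq_of_le_of_finrank_eq (sup_le (p.1.2.2.symm.trans_le inf_le_right) ?_)
      (((F p).2.finrank_sup_span hWA).trans p.1.2.1.symm)
    rw [Submodule.span_le]
    rintro _ ⟨i, rfl⟩
    exact (p.2.1 i).2
  have hF : Function.Bijective F := by
    constructor
    · intro p p' h
      have h1 : p.1 = p'.1 := Subtype.ext (by rw [← hspan p, ← hspan p', h])
      obtain ⟨T, g, hg⟩ := p
      obtain ⟨T', g', hg'⟩ := p'
      obtain rfl : T = T' := h1
      congr 2
      ext i
      exact congrFun (congrArg Subtype.val h) i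
    · rintro ⟨f, hf⟩
      let T : 𝒯 := ⟨W ⊔ Submodule.span K (Set.range f), hf.finrank_sup_span hWA,
        hf.inf_sup_span_eq hWA⟩
      have hmem : ∀ i, f i ∈ T.1 := fun i =>
        Submodule.mem_sup_right (Submodule.subset_span ⟨i, rfl⟩)
      exact ⟨⟨T, fun i => ⟨f i, hmem i⟩, (linearIndependent_mkQ_comap_iff T.2.2 _).2 hf⟩, rfl⟩
  have : Fintype 𝒯 := Fintype.ofFinite 𝒯
  have hcard := Nat.card_congr (Equiv.ofBijective F hF)
  have hfib : ∀ T : 𝒯, Nat.card {g : Fin m → T.1 //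
      LinearIndependent K ((W.comap T.1.subtype).mkQ ∘ g)} =
      (Fintype.card K ^ Module.finrank K W) ^ m *
        ∏ j : Fin m, (Fintype.card K ^ m - Fintype.card K ^ (j : ℕ)) := fun T => by
    have hW : Module.finrank K (W.comap T.1.subtype) = Module.finrank K W :=
      (Submodule.comapSubtypeEquivOfLe (T.2.2.symm.trans_le inf_le_right : W ≤ T.1)).finrank_eq
    have hq := (W.comap T.1.subtype).finrank_quotient_add_finrank
    rw [Nat.card_linearIndependent_mkQ, hW, show Module.finrank K (T.1 ⧸ W.comap T.1.subtype) = m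
      by rw [hW, T.2.1] at hq; omega]
  have hq := A.finrank_quotient_add_finrank
  rw [Nat.card_sigma, Finset.sum_congr rfl fun T _ => hfib T, Finset.sum_const, smul_eq_mul,
    Nat.card_linearIndependent_mkQ, Finset.card_univ, ← Nat.card_eq_fintype_card,
    Nat.card_coe_set_eq, show Module.finrank K (V ⧸ A) = Module.finrank K V - Module.finrank K A
      by omega] at hcard
  exact hcard

end Counting

/-! ### Counts expressed by Gaussian binomials -/

section GaussianBinomial

theorem prod_pow_sub_pow_ne_zero {q : ℕ} (hq : 2 ≤ q) (m : ℕ) :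
    ∏ j ∈ Finset.range m, ((q : ℚ) ^ m - (q : ℚ) ^ j) ≠ 0 := by
  refine Finset.prod_ne_zero_iff.2 fun j hj => sub_ne_zero.2 (ne_of_gt ?_)
  exact_mod_cast Nat.pow_lt_pow_right (by omega) (Finset.mem_range.1 hj)

theorem gaussBinom_self {q : ℕ} (hq : 2 ≤ q) (m : ℕ) : gaussBinom q m m = 1 := by
  refine Finset.prod_eq_one fun j hj => div_self (sub_ne_zero.2 (ne_of_gt ?_))
  have := Finset.mem_range.1 hj
  exact_mod_cast Nat.one_lt_pow (by omega) (by omega)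

theorem cast_prod_pow_sub_pow {q : ℕ} (hq : 2 ≤ q) (N m : ℕ) :
    ((∏ j : Fin m, (q ^ N - q ^ (j : ℕ)) : ℕ) : ℚ) =
      gaussBinom q N m * ∏ j ∈ Finset.range m, ((q : ℚ) ^ m - (q : ℚ) ^ j) := by
  rw [Fin.prod_univ_eq_prod_range (fun j => q ^ N - q ^ j) m, gaussBinom,
    ← Finset.prod_mul_distrib, Nat.cast_prod]
  by_cases hm : m ≤ N
  · refine Finset.prod_congr rfl fun j hj => ?_
    have hj := Finset.mem_range.1 hj
    have key : ∀ M, j ≤ M → (q : ℚ) ^ M - (q : ℚ) ^ j = (q : ℚ) ^ j * ((q : ℚ) ^ (M - j) - 1) :=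
      fun M hM => by rw [mul_sub, ← pow_add, Nat.add_sub_cancel' hM, mul_one]
    have hne : (q : ℚ) ^ (m - j) - 1 ≠ 0 := by
      refine sub_ne_zero.2 (ne_of_gt ?_)
      exact_mod_cast Nat.one_lt_pow (by omega) (by omega)
    rw [Nat.cast_sub (Nat.pow_le_pow_right (by omega) (by omega)), Nat.cast_pow, Nat.cast_pow,
      key N (by omega), key m hj.le]
    field_simp
  · have hN := Finset.mem_range.2 (not_le.1 hm)
    rw [Finset.prod_eq_zero hN (by simp), Finset.prod_eq_zero hN (by simp)]

variable {K V : Type*} [Field K] [Fintype K] [AddCommGroup V] [Module K V] [Finite V]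

theorem ncard_inf_eq (A W : Submodule K V) (hWA : W ≤ A) {b : ℕ}
    (hb : Module.finrank K W ≤ b) :
    ({T : Submodule K V | Module.finrank K T = b ∧ A ⊓ T = W}.ncard : ℚ) =
      (Fintype.card K : ℚ) ^ ((Module.finrank K A - Module.finrank K W) *
        (b - Module.finrank K W)) *
      gaussBinom (Fintype.card K) (Module.finrank K V - Module.finrank K A)
        (b - Module.finrank K W) := by
  have : FiniteDimensional K V := Module.Finite.of_finite
  have hq : 2 ≤ Fintype.card K := Fintype.one_lt_card
  obtain ⟨m, rfl⟩ := Nat.exists_eq_add_of_le hb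
  obtain ⟨d, hd⟩ := Nat.exists_eq_add_of_le (Submodule.finrank_mono hWA)
  have h := congrArg (Nat.cast : ℕ → ℚ) (ncard_inf_eq_mul A W hWA m)
  rw [Nat.cast_mul, Nat.cast_mul, Nat.cast_mul, cast_prod_pow_sub_pow hq,
    cast_prod_pow_sub_pow hq, gaussBinom_self hq, one_mul] at h
  have h1 := prod_pow_sub_pow_ne_zero hq m
  have h2 : (Fintype.card K : ℚ) ≠ 0 := by positivity
  rw [← mul_assoc, ← mul_assoc] at h
  have h3 := mul_right_cancel₀ h1 h
  rw [hd] at h3 ⊢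
  rw [Nat.add_sub_cancel_left, Nat.add_sub_cancel_left, pow_mul]
  push_cast at h3
  rw [pow_add, mul_pow, mul_comm, mul_assoc] at h3
  exact mul_left_cancel₀ (pow_ne_zero _ (pow_ne_zero _ h2)) h3

theorem ncard_kSubspaces (k : ℕ) :
    ((kSubspaces K V k).ncard : ℚ) = gaussBinom (Fintype.card K) (Module.finrank K V) k := by
  have h := ncard_inf_eq (⊥ : Submodule K V) ⊥ le_rfl (b := k) (by simp)
  simpa [kSubspaces] using h

/-- Classify `T` by the `i`-space `A ⊓ T`: all fibres have the same size. -/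
theorem ncard_finrank_inf_eq (A : Submodule K V) {b i : ℕ} (hb : i ≤ b) :
    ({T : Submodule K V | Module.finrank K T = b ∧
      Module.finrank K (A ⊓ T : Submodule K V) = i}.ncard : ℚ) =
      (Fintype.card K : ℚ) ^ ((Module.finrank K A - i) * (b - i)) *
        gaussBinom (Fintype.card K) (Module.finrank K A) i *
        gaussBinom (Fintype.card K) (Module.finrank K V - Module.finrank K A) (b - i) := by
  let 𝒯 : Submodule K A → Set (Submodule K V) := fun W =>
    {T | Module.finrank K T = b ∧ A ⊓ T = W.map A.subtype}
  have hunion : {T : Submodule K V | Module.finrank K T = b ∧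
      Module.finrank K (A ⊓ T : Submodule K V) = i} = ⋃ W ∈ kSubspaces K A i, 𝒯 W := by
    ext T
    simp only [Set.mem_ofPred_eq, Set.mem_iUnion, exists_prop, kSubspaces, 𝒯]
    constructor
    · rintro ⟨h1, h2⟩
      refine ⟨T.comap A.subtype, ?_, h1, (Submodule.map_comap_subtype A T).symm⟩
      rw [← h2, ← Submodule.map_comap_subtype]
      exact (Submodule.finrank_map_subtype_eq A _).symm
    · rintro ⟨W, hW, h1, h2⟩
      exact ⟨h1, by rw [h2, Submodule.finrank_map_subtype_eq, hW]⟩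
  have hdisj : (kSubspaces K A i).PairwiseDisjoint 𝒯 := fun W _ W' _ hne =>
    Set.disjoint_left.2 fun T hT hT' => hne
      (Submodule.map_injective_of_injective A.injective_subtype (hT.2.symm.trans hT'.2))
  have hcard := (Set.toFinite (kSubspaces K A i)).ncard_biUnion
    (fun W _ => Set.toFinite (𝒯 W)) hdisj
  rw [finsum_mem_eq_finite_toFinset_sum _ (Set.toFinite (kSubspaces K A i))] at hcard
  have hfib : ∀ W ∈ (Set.toFinite (kSubspaces K A i)).toFinset, ((𝒯 W).ncard : ℚ) =
      (Fintype.card K : ℚ) ^ ((Module.finrank K A - i) * (b - i)) *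
        gaussBinom (Fintype.card K) (Module.finrank K V - Module.finrank K A) (b - i) := by
    intro W hW
    have hWi : Module.finrank K (W.map A.subtype) = i := by
      rw [Submodule.finrank_map_subtype_eq]
      exact (Set.toFinite (kSubspaces K A i)).mem_toFinset.1 hW
    have h := ncard_inf_eq A (W.map A.subtype) (Submodule.map_subtype_le A W) (b := b)
      (hWi.trans_le hb)
    rwa [hWi] at h
  rw [hunion, hcard, Nat.cast_sum, Finset.sum_congr rfl hfib, Finset.sum_const, nsmul_eq_mul,
    ← Set.ncard_eq_toFinset_card, ncard_kSubspaces]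
  ring

theorem ncard_nbhd (A : Submodule K V) {b t : ℕ} (hb : t ≤ b) :
    ((nbhd t b A).ncard : ℚ) = ∑ i ∈ Finset.range t,
      (Fintype.card K : ℚ) ^ ((Module.finrank K A - i) * (b - i)) *
        gaussBinom (Fintype.card K) (Module.finrank K A) i *
        gaussBinom (Fintype.card K) (Module.finrank K V - Module.finrank K A) (b - i) := by
  have hunion : nbhd t b A = ⋃ i ∈ (Finset.range t : Set ℕ), {T : Submodule K V |
      Module.finrank K T = b ∧ Module.finrank K (A ⊓ T : Submodule K V) = i} := by
    ext T
    simp [nbhd, kSubspaces, and_comm]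
  have hdisj : ((Finset.range t : Finset ℕ) : Set ℕ).PairwiseDisjoint fun i =>
      {T : Submodule K V | Module.finrank K T = b ∧
        Module.finrank K (A ⊓ T : Submodule K V) = i} := fun i _ j _ hne =>
    Set.disjoint_left.2 fun T hT hT' => hne (hT.2.symm.trans hT'.2)
  rw [hunion, (Set.toFinite _).ncard_biUnion (fun _ _ => Set.toFinite _) hdisj,
    finsum_mem_coe_finset, Nat.cast_sum]
  exact Finset.sum_congr rfl fun i hi =>
    ncard_finrank_inf_eq A ((Finset.mem_range.1 hi).le.trans hb)

end GaussianBinomial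

/-! ### Comparing the two singleton configurations -/

section Comparison

theorem nbhd_subset {K V : Type*} [Field K] [AddCommGroup V] [Module K V] (t k : ℕ)
    (S : Submodule K V) : nbhd t k S ⊆ kSubspaces K V k :=
  fun _ hT => hT.1

variable {K V : Type*} [Field K] [Fintype K] [AddCommGroup V] [Module K V] [Finite V]

theorem cast_ncard_kSubspaces_diff_nbhd (t k : ℕ) (S : Submodule K V) :
    ((kSubspaces K V k \ nbhd t k S).ncard : ℚ) =
      (kSubspaces K V k).ncard - (nbhd t k S).ncard := by
  rw [← Set.ncard_sdiff_add_ncard_of_subset (nbhd_subset t k S) (Set.toFinite _)]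
  push_cast
  ring

theorem ncard_nbhd_congr {t b : ℕ} (htb : t ≤ b) {S S' : Submodule K V}
    (h : Module.finrank K S = Module.finrank K S') : (nbhd t b S).ncard = (nbhd t b S').ncard := by
  have h' : ((nbhd t b S).ncard : ℚ) = (nbhd t b S').ncard := by
    rw [ncard_nbhd S htb, ncard_nbhd S' htb, h]
  exact_mod_cast h'

/-- Double counting of the pairs of subspaces meeting in dimension less than `t`. -/
theorem ncard_kSubspaces_mul_ncard_nbhd {t a b : ℕ} (hta : t ≤ a) (htb : t ≤ b)
    {A B : Submodule K V} (hA : Module.finrank K A = a) (hB : Module.finrank K B = b) :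
    (kSubspaces K V a).ncard * (nbhd t b A).ncard =
      (kSubspaces K V b).ncard * (nbhd t a B).ncard := by
  classical
  have hfa := Set.toFinite (kSubspaces K V a)
  have hfb := Set.toFinite (kSubspaces K V b)
  rw [Set.ncard_eq_toFinset_card _ hfa, Set.ncard_eq_toFinset_card _ hfb]
  refine Finset.card_mul_eq_card_mul
    (fun S T : Submodule K V => Module.finrank K (S ⊓ T : Submodule K V) < t) (fun S hS => ?_)
    (fun T hT => ?_)
  · rw [ncard_nbhd_congr htb (hA.trans (hfa.mem_toFinset.1 hS).symm), ← Set.ncard_coe_finset]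
    congr 1
    ext T
    simp [nbhd, Finset.bipartiteAbove]
  · rw [ncard_nbhd_congr hta (hB.trans (hfb.mem_toFinset.1 hT).symm), ← Set.ncard_coe_finset]
    congr 1
    ext S
    simp only [nbhd, kSubspaces, Finset.bipartiteBelow, Finset.coe_filter, Set.mem_ofPred_eq,
      Set.Finite.mem_toFinset]
    rw [inf_comm]

theorem ncard_nbhd_lt {t b : ℕ} {A : Submodule K V} (htA : t ≤ Module.finrank K A) (htb : t ≤ b)
    (hb : b ≤ Module.finrank K V) : (nbhd t b A).ncard < (kSubspaces K V b).ncard := by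
  have : FiniteDimensional K V := Module.Finite.of_finite
  obtain ⟨E, -, hEA, hE⟩ := Submodule.exists_le_le_finrank_eq (bot_le : ⊥ ≤ A) (by simp) htA
  obtain ⟨B, hEB, -, hB⟩ := Submodule.exists_le_le_finrank_eq (le_top : E ≤ ⊤) (hE.trans_le htb)
    (hb.trans (finrank_top K V).ge)
  refine Set.ncard_lt_ncard ⟨nbhd_subset t b A, fun h =>
    (h (show B ∈ kSubspaces K V b from hB)).2.not_ge ?_⟩
  exact hE.ge.trans (Submodule.finrank_mono (le_inf hEA hEB))

/-- Complementing the double count shows that the two sizes are in the ratio of the numbers of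
`a`-spaces and `b`-spaces. Both conclusions follow because the size on the `b`-side is positive. -/
theorem ncard_kSubspaces_diff_nbhd_le {t a b : ℕ} (hta : t ≤ a) (htb : t ≤ b)
    {A B : Submodule K V} (hA : Module.finrank K A = a) (hB : Module.finrank K B = b)
    (hle : (kSubspaces K V a).ncard ≤ (kSubspaces K V b).ncard) :
    (kSubspaces K V a \ nbhd t a B).ncard ≤ (kSubspaces K V b \ nbhd t b A).ncard ∧
      ((kSubspaces K V a \ nbhd t a B).ncard = (kSubspaces K V b \ nbhd t b A).ncard ↔
        (kSubspaces K V a).ncard = (kSubspaces K V b).ncard) := by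
  have : FiniteDimensional K V := Module.Finite.of_finite
  have h1 := ncard_nbhd_lt (hta.trans hA.ge) htb (hB ▸ Submodule.finrank_le B)
  have h2 := Set.ncard_sdiff_add_ncard_of_subset (nbhd_subset t b A) (Set.toFinite _)
  have h3 := Set.ncard_sdiff_add_ncard_of_subset (nbhd_subset t a B) (Set.toFinite _)
  have h4 := ncard_kSubspaces_mul_ncard_nbhd hta htb hA hB
  set x := (kSubspaces K V a).ncard
  set y := (kSubspaces K V b).ncard
  have h5 : x * (kSubspaces K V b \ nbhd t b A).ncard =
      y * (kSubspaces K V a \ nbhd t a B).ncard := by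
    refine Nat.add_right_cancel (m := y * (nbhd t a B).ncard) ?_
    rw [← mul_add, h3, ← h4, ← mul_add, h2, mul_comm]
  have hpos : 0 < (kSubspaces K V b \ nbhd t b A).ncard := by omega
  have hy : 0 < y := by omega
  refine ⟨Nat.le_of_mul_le_mul_left (h5 ▸ Nat.mul_le_mul_right _ hle) hy, fun h => ?_, fun h => ?_⟩
  · rw [h] at h5
    exact Nat.eq_of_mul_eq_mul_right hpos h5
  · rw [h] at h5
    exact (Nat.eq_of_mul_eq_mul_left hy h5).symm

/-- Bound and extremal cases for cross pairs, with subspaces not yet counted. -/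
theorem IsCrossPair.ncard_add_ncard_le {t a b : ℕ} (ht : 1 ≤ t) (hta : t ≤ a) (htb : t ≤ b)
    (hab : a + b < Module.finrank K V + t)
    (hle : (kSubspaces K V a).ncard ≤ (kSubspaces K V b).ncard)
    {𝒜 ℬ : Set (Submodule K V)} (h : IsCrossPair t a b 𝒜 ℬ) {A₀ : Submodule K V}
    (hA₀ : Module.finrank K A₀ = a) :
    𝒜.ncard + ℬ.ncard ≤ 1 + (kSubspaces K V b \ nbhd t b A₀).ncard ∧
    (𝒜.ncard + ℬ.ncard = 1 + (kSubspaces K V b \ nbhd t b A₀).ncard ↔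
      (∃ A ∈ kSubspaces K V a, 𝒜 = {A} ∧ ℬ = kSubspaces K V b \ nbhd t b A) ∨
      ((kSubspaces K V a).ncard = (kSubspaces K V b).ncard ∧
        ∃ B ∈ kSubspaces K V b, ℬ = {B} ∧ 𝒜 = kSubspaces K V a \ nbhd t a B)) := by
  have hcongr : ∀ A : Submodule K V, A ∈ kSubspaces K V a →
      (kSubspaces K V b \ nbhd t b A).ncard = (kSubspaces K V b \ nbhd t b A₀).ncard := by
    intro A hA
    have h1 := Set.ncard_sdiff_add_ncard_of_subset (nbhd_subset t b A) (Set.toFinite _)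
    have h2 := Set.ncard_sdiff_add_ncard_of_subset (nbhd_subset t b A₀) (Set.toFinite _)
    have h3 := ncard_nbhd_congr htb ((show Module.finrank K A = a from hA).trans hA₀.symm)
    omega
  have hbound : ∀ {𝒞 𝒟 : Set (Submodule K V)}, IsCrossPair t a b 𝒞 𝒟 →
      𝒞.ncard + 𝒟.ncard ≤ 1 + (kSubspaces K V b \ nbhd t b A₀).ncard := by
    intro 𝒞 𝒟 h
    obtain ⟨𝒜', ℬ', hmax⟩ := h.exists_isMaxCrossPair
    refine (hmax.ncard_add_le _ _ h).trans ?_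
    rcases hmax.singleton_or_singleton ht hta htb hab with ⟨A, hA, rfl, rfl⟩ | ⟨B, hB, rfl, rfl⟩
    · rw [Set.ncard_singleton, hcongr A hA]
    · rw [Set.ncard_singleton, add_comm]
      exact Nat.add_le_add_left (ncard_kSubspaces_diff_nbhd_le hta htb hA₀ hB hle).1 1
  refine ⟨hbound h, fun heq => ?_, ?_⟩
  · have hmax : IsMaxCrossPair t a b 𝒜 ℬ := ⟨h, fun _ _ h' => heq ▸ hbound h'⟩
    refine (hmax.singleton_or_singleton ht hta htb hab).imp id ?_
    rintro ⟨B, hB, rfl, rfl⟩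
    rw [Set.ncard_singleton, add_comm, Nat.add_left_cancel_iff] at heq
    exact ⟨(ncard_kSubspaces_diff_nbhd_le hta htb hA₀ hB hle).2.1 heq, B, hB, rfl, rfl⟩
  · rintro (⟨A, hA, rfl, rfl⟩ | ⟨heq, B, hB, rfl, rfl⟩)
    · rw [Set.ncard_singleton, hcongr A hA]
    · rw [Set.ncard_singleton, add_comm,
        (ncard_kSubspaces_diff_nbhd_le hta htb hA₀ hB hle).2.2 heq]

end Comparison

theorem theorem1p3 {K V : Type*} [Field K] [Fintype K] [AddCommGroup V] [Module K V]
    (q n a b t : ℕ) (hq : Fintype.card K = q) (hV : Module.finrank K V = n)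
    (hn : 4 ≤ n) (ha : 2 ≤ a) (hb : 2 ≤ b) (ht : 1 ≤ t) (htab : t < min a b)
    (habn : a + b < n + t) (hle : gaussBinom q n a ≤ gaussBinom q n b)
    (𝒜 ℬ : Set (Submodule K V)) (h𝒜 : 𝒜 ⊆ kSubspaces K V a) (hℬ : ℬ ⊆ kSubspaces K V b)
    (h𝒜ne : 𝒜.Nonempty) (hℬne : ℬ.Nonempty) (hcross : CrossIntersecting t 𝒜 ℬ) :
    ((𝒜.ncard : ℚ) + (ℬ.ncard : ℚ) ≤
      gaussBinom q n b
        - ∑ i ∈ Finset.range t,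
            (q : ℚ) ^ ((a - i) * (b - i)) * gaussBinom q a i * gaussBinom q (n - a) (b - i)
        + 1) ∧
    ((𝒜.ncard : ℚ) + (ℬ.ncard : ℚ) =
      gaussBinom q n b
        - ∑ i ∈ Finset.range t,
            (q : ℚ) ^ ((a - i) * (b - i)) * gaussBinom q a i * gaussBinom q (n - a) (b - i)
        + 1 ↔
      (∃ A ∈ kSubspaces K V a, 𝒜 = {A} ∧ ℬ = kSubspaces K V b \ nbhd t b A) ∨
      (gaussBinom q n a = gaussBinom q n b ∧
        ∃ B ∈ kSubspaces K V b, ℬ = {B} ∧ 𝒜 = kSubspaces K V a \ nbhd t a B)) := by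
  have hfin : FiniteDimensional K V := Module.finite_of_finrank_pos (by omega)
  have : Finite V := Module.finite_of_finite K
  subst hq hV
  have hta : t ≤ a := by omega
  have htb : t ≤ b := by omega
  obtain ⟨A₀, hA₀'⟩ := h𝒜ne
  have hA₀ : Module.finrank K A₀ = a := h𝒜 hA₀'
  simp only [← ncard_kSubspaces (K := K) (V := V)] at hle ⊢
  have hle' : (kSubspaces K V a).ncard ≤ (kSubspaces K V b).ncard := by exact_mod_cast hle
  have key := IsCrossPair.ncard_add_ncard_le ht hta htb habn hle'
    ⟨h𝒜, hℬ, ⟨A₀, hA₀'⟩, hℬne, hcross⟩ hA₀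
  have hbound := cast_ncard_kSubspaces_diff_nbhd t b A₀
  rw [ncard_nbhd A₀ htb, hA₀] at hbound
  rw [← hbound, add_comm _ (1 : ℚ)]
  exact_mod_cast key
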